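/- Let $0<\alpha<\tfrac12$ and $0<\gamma\le 2\alpha$. A sequence $(Y_k)_k$ of real random variables satisfies an LDP (or MDP) with speed $v(k)\to\infty$ and rate function $I:\mathbb R\to[0,\infty]$ if the level sets $\{I\le L\}$, $0\le L<\infty$, are compact, $\liminf_{k}\frac1{v(k)}\log\mathbb P(Y_k\in G)\ge-\inf_{G}I$ for every open $G\subseteq\mathbb R$, and $\limsup_{k}\frac1{v(k)}\log\mathbb P(Y_k\in A)\le-\inf_{A}I$ for every closed $A\subseteq\mathbb R$. Let $(X_i)_{i\ge1}$ be i.i.d. real random variables with $\mathbb E X_1=0$, $\mathbb V(X_1)=1$ and $\mathbb E\,e^{\lambda X_1}<\infty$ for all $\lambda\in(-D,D)$, for some $D>0$. For each $k$ let $\nu_k$ be a random variable with values in $\{0,1,2,\dots\}$, independent of the sequence $(X_i)_i$, with finite mean $\mu_k=\mathbb E\nu_k$, and suppose $\mu_k\to\infty$ as $k\to\infty$. Suppose that $\bigl(\nu_k/\mu_k^{1+2\alpha-\gamma}\bigr)_k$ satisfies an LDP with speed $\mu_k^{\gamma}$ and a convex rate function $I:\mathbb R\to[0,\infty]$ such that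 $\lim_{y\to\infty}I(y)=\infty$ and $I(s)<\infty$ for at least one $s>0$. Then the random variables $$Z_{k,\alpha}=\frac1{\mu_k^{1/2+\alpha}}\sum_{i=1}^{\nu_k}X_i$$ satisfy an MDP with speed $\mu_k^{\gamma}$ and rate function $$J(y)=\inf_{s>0}\Bigl\{\frac{y^2}{2s}+I(s)\Bigr\},\qquad y\in\mathbb R.$$ -/

import Mathlib

open MeasureTheory ProbabilityTheory Filter Topology
open scoped ENNReal NNReal

/-- The sequence of real random variables `Y` obeys, under `P`, a large deviation principle with
speed `v` (where `v n → ∞`) and good rate function `I : ℝ → [0, ∞]`: the level sets of `I` are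
compact, and the usual lower bound on open sets and upper bound on closed sets hold.  Logarithms
and limits are taken in the extended reals, with `log 0 = -∞`. -/
structure SatisfiesLDP {Ω : Type*} [MeasurableSpace Ω] (P : Measure Ω)
    (Y : ℕ → Ω → ℝ) (v : ℕ → ℝ) (I : ℝ → ℝ≥0∞) : Prop where
  speed_tendsto : Tendsto v atTop atTop
  isCompact_level : ∀ L : ℝ≥0, IsCompact {x : ℝ | I x ≤ (L : ℝ≥0∞)}
  lower_bound : ∀ G : Set ℝ, IsOpen G →
    -((⨅ x ∈ G, I x : ℝ≥0∞) : EReal) ≤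
      liminf (fun n => (((1 / v n : ℝ)) : EReal) * ENNReal.log (P {ω | Y n ω ∈ G})) atTop
  upper_bound : ∀ A : Set ℝ, IsClosed A →
    limsup (fun n => (((1 / v n : ℝ)) : EReal) * ENNReal.log (P {ω | Y n ω ∈ A})) atTop ≤
      -((⨅ x ∈ A, I x : ℝ≥0∞) : EReal)

/-- The expectation `μ k = E (ν k)` of the random summation index. -/
noncomputable def indexMean {Ω : Type*} [MeasurableSpace Ω] (P : Measure Ω)
    (ν : ℕ → Ω → ℕ) (k : ℕ) : ℝ :=
  ∫ ω, (ν k ω : ℝ) ∂P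

/-- The rescaled random sum `Z k = (μ k) ^ (-(1/2 + α)) * (sum of the first ν k variables X i)`;
the summands are numbered from `0`. -/
noncomputable def scaledRandomSum {Ω : Type*} [MeasurableSpace Ω] (P : Measure Ω)
    (X : ℕ → Ω → ℝ) (ν : ℕ → Ω → ℕ) (α : ℝ) (k : ℕ) (ω : Ω) : ℝ :=
  1 / (indexMean P ν k) ^ (1 / 2 + α) * ∑ i ∈ Finset.range (ν k ω), X i ω

/-- The rate function `J y = inf {y ^ 2 / (2 s) + I s : s > 0}`. -/
noncomputable def mixedRate (I : ℝ → ℝ≥0∞) (y : ℝ) : ℝ≥0∞ :=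
  ⨅ s ∈ Set.Ioi (0 : ℝ), (ENNReal.ofReal (y ^ 2 / (2 * s)) + I s)

/-! ### Scaled logarithms of probabilities and exponential bounds -/

/-! Write a = μ^(1/2+α), b = μ^(1+2α-γ) and r = μ^γ, so that a² = r b and a/b → 0. If the index is
about s b, the sum reaches y a with probability about exp(-(y a)²/(2 s b)) = exp(-r y²/(2s)). Here
a/b → 0 keeps the tilting parameter near 0, where the cumulant generating function is t²/2 to second
order. The index is near s b at cost r I(s). By independence the costs add, and the cheapest s gives
the rate.

The Gaussian estimates, uniform over the index window, are `eventually_measure_abs_sum_ge_le`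
(Chernoff) and `exists_eventually_le_measure_abs_sum_sub_lt` (tilting and Chebyshev). The lower
bound uses one near-optimal s. For the upper bound, the rate is even and nondecreasing in |y|, so
two-sided tails suffice; `exists_eventually_measure_abs_randomSum_ge_le` cuts off large indices
using I → ∞ and covers the remaining compact range by finitely many balls. The delicate point is s =
0, which the infimum excludes: convexity handles it in `mixedRate_zero_le`. -/

lemma scaled_log_le_iff {v x : ℝ} (hv : 0 < v) {p : ℝ≥0∞} (hp : p ≠ ∞) :
    ((1 / v : ℝ) : EReal) * ENNReal.log p ≤ x ↔ p ≤ ENNReal.ofReal (Real.exp (v * x)) := by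
  rcases eq_or_ne p 0 with rfl | h0
  · simp [EReal.coe_mul_bot_of_pos (inv_pos.2 hv)]
  · have hpos : 0 < p.toReal := ENNReal.toReal_pos h0 hp
    rw [ENNReal.log_pos_real h0 hp, ← EReal.coe_mul, EReal.coe_le_coe_iff,
      ← ENNReal.toReal_le_toReal hp ENNReal.ofReal_ne_top,
      ENNReal.toReal_ofReal (Real.exp_pos _).le, ← Real.log_le_iff_le_exp hpos,
      one_div, inv_mul_le_iff₀ hv]

lemma le_scaled_log_iff {v x : ℝ} (hv : 0 < v) {p : ℝ≥0∞} (hp : p ≠ ∞) :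
    (x : EReal) ≤ ((1 / v : ℝ) : EReal) * ENNReal.log p ↔ ENNReal.ofReal (Real.exp (v * x)) ≤ p := by
  rcases eq_or_ne p 0 with rfl | h0
  · simp [EReal.coe_mul_bot_of_pos (inv_pos.2 hv), Real.exp_pos]
  · have hpos : 0 < p.toReal := ENNReal.toReal_pos h0 hp
    rw [ENNReal.log_pos_real h0 hp, ← EReal.coe_mul, EReal.coe_le_coe_iff,
      ← ENNReal.toReal_le_toReal ENNReal.ofReal_ne_top hp,
      ENNReal.toReal_ofReal (Real.exp_pos _).le, ← Real.le_log_iff_exp_le hpos,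
      one_div, le_inv_mul_iff₀ hv]

section ScaledLog

variable {v : ℕ → ℝ} {p : ℕ → ℝ≥0∞}

lemma eventually_le_exp_of_limsup_le (hv : Tendsto v atTop atTop) (hp : ∀ n, p n ≠ ∞)
    {i : ℝ≥0∞} {c : ℝ} (hc : (c : EReal) < i)
    (h : limsup (fun n => ((1 / v n : ℝ) : EReal) * ENNReal.log (p n)) atTop ≤ -(i : EReal)) :
    ∀ᶠ n in atTop, p n ≤ ENNReal.ofReal (Real.exp (-(v n * c))) := by
  have h1 : limsup (fun n => ((1 / v n : ℝ) : EReal) * ENNReal.log (p n)) atTop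
      < ((-c : ℝ) : EReal) := by
    refine h.trans_lt ?_
    rw [EReal.coe_neg]
    exact EReal.neg_lt_neg_iff.2 hc
  filter_upwards [eventually_lt_of_limsup_lt h1, hv.eventually_gt_atTop 0] with n hn hvn
  rw [← mul_neg]
  exact (scaled_log_le_iff hvn (hp n)).1 hn.le

lemma eventually_exp_le_of_le_liminf (hv : Tendsto v atTop atTop) (hp : ∀ n, p n ≠ ∞)
    {i : ℝ≥0∞} {c : ℝ} (hc : (i : EReal) < c)
    (h : -(i : EReal) ≤ liminf (fun n => ((1 / v n : ℝ) : EReal) * ENNReal.log (p n)) atTop) :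
    ∀ᶠ n in atTop, ENNReal.ofReal (Real.exp (-(v n * c))) ≤ p n := by
  have h1 : ((-c : ℝ) : EReal) <
      liminf (fun n => ((1 / v n : ℝ) : EReal) * ENNReal.log (p n)) atTop := by
    refine lt_of_lt_of_le ?_ h
    rw [EReal.coe_neg]
    exact EReal.neg_lt_neg_iff.2 hc
  filter_upwards [eventually_lt_of_lt_liminf h1, hv.eventually_gt_atTop 0] with n hn hvn
  rw [← mul_neg]
  exact (le_scaled_log_iff hvn (hp n)).1 hn.le

/-- Constant factors such as C cost nothing because the speed diverges; this is what permits finite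
unions in the upper bound. -/
lemma limsup_scaled_log_le (hv : Tendsto v atTop atTop) (hp : ∀ n, p n ≠ ∞)
    {i : ℝ≥0∞} (h : ∀ c : ℝ, (c : EReal) < i → ∃ C : ℝ, ∀ᶠ n in atTop,
      p n ≤ ENNReal.ofReal (C * Real.exp (-(v n * c)))) :
    limsup (fun n => ((1 / v n : ℝ) : EReal) * ENNReal.log (p n)) atTop ≤ -(i : EReal) := by
  rw [EReal.le_neg]
  refine EReal.ge_of_forall_gt_iff_ge.1 fun c hc => ?_
  rw [EReal.le_neg, ← EReal.coe_neg]
  refine EReal.le_of_forall_lt_iff_le.1 fun d hd => ?_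
  rw [EReal.coe_lt_coe_iff] at hd
  obtain ⟨C, hC⟩ := h c hc
  have hpos : 0 < c + d := by linarith
  refine limsup_le_of_le (h := ?_)
  filter_upwards [hC, hv.eventually_gt_atTop 0, hv.eventually_ge_atTop (C / (c + d))]
    with n hn hvn hvC
  refine (scaled_log_le_iff hvn (hp n)).2 (hn.trans (ENNReal.ofReal_le_ofReal ?_))
  rw [div_le_iff₀ hpos] at hvC
  have : C ≤ Real.exp (v n * (c + d)) := by
    linarith [Real.add_one_le_exp (v n * (c + d))]
  calc C * Real.exp (-(v n * c)) ≤ Real.exp (v n * (c + d)) * Real.exp (-(v n * c)) := by gcongr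
    _ = Real.exp (v n * d) := by rw [← Real.exp_add]; ring_nf

lemma le_liminf_scaled_log (hv : Tendsto v atTop atTop) (hp : ∀ n, p n ≠ ∞)
    {i : ℝ≥0∞} (h : ∀ c : ℝ, (i : EReal) < c → ∃ C : ℝ, 0 < C ∧ ∀ᶠ n in atTop,
      ENNReal.ofReal (C * Real.exp (-(v n * c))) ≤ p n) :
    -(i : EReal) ≤ liminf (fun n => ((1 / v n : ℝ) : EReal) * ENNReal.log (p n)) atTop := by
  rw [EReal.neg_le]
  refine EReal.le_of_forall_lt_iff_le.1 fun c hc => ?_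
  rw [EReal.neg_le, ← EReal.coe_neg]
  refine EReal.ge_of_forall_gt_iff_ge.1 fun d hd => ?_
  rw [EReal.coe_lt_coe_iff] at hd
  obtain ⟨C, hC0, hC⟩ := h c hc
  have hpos : 0 < -(c + d) := by linarith
  refine le_liminf_of_le (h := ?_)
  filter_upwards [hC, hv.eventually_gt_atTop 0, hv.eventually_ge_atTop (C⁻¹ / (-(c + d)))]
    with n hn hvn hvC
  refine (le_scaled_log_iff hvn (hp n)).2 ((ENNReal.ofReal_le_ofReal ?_).trans hn)
  rw [div_le_iff₀ hpos] at hvC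
  have h1 : C⁻¹ ≤ Real.exp (v n * -(c + d)) := by
    linarith [Real.add_one_le_exp (v n * -(c + d))]
  have h2 : Real.exp (v n * (c + d)) ≤ C := by
    rw [mul_neg, Real.exp_neg] at h1
    exact (inv_le_inv₀ hC0 (Real.exp_pos _)).1 h1
  calc Real.exp (v n * d) = Real.exp (v n * (c + d)) * Real.exp (-(v n * c)) := by
        rw [← Real.exp_add]; ring_nf
    _ ≤ C * Real.exp (-(v n * c)) := by gcongr

end ScaledLog

/-! ### Moderate deviations of a single sum -/

section SingleSum

variable {Ω : Type*} [MeasurableSpace Ω] {P : Measure Ω} [IsProbabilityMeasure P]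

lemma measure_abs_ge_le_exp_cgf {S : Ω → ℝ} {t x c : ℝ} (ht : 0 ≤ t)
    (hint : Integrable (fun ω => Real.exp (t * S ω)) P)
    (hint' : Integrable (fun ω => Real.exp (-t * S ω)) P)
    (hc : cgf S P t ≤ c) (hc' : cgf S P (-t) ≤ c) :
    P {ω | x ≤ |S ω|} ≤ ENNReal.ofReal (2 * Real.exp (-(t * x) + c)) := by
  have h1 := measure_ge_le_exp_cgf x ht hint
  have h2 := measure_le_le_exp_cgf (-x) (neg_nonpos.2 ht) hint'
  rw [← ENNReal.ofReal_toReal (measure_ne_top P {ω | x ≤ |S ω|})]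
  refine ENNReal.ofReal_le_ofReal ?_
  calc P.real {ω | x ≤ |S ω|} ≤ P.real ({ω | x ≤ S ω} ∪ {ω | S ω ≤ -x}) := by
        refine measureReal_mono fun ω hω => ?_
        rcases le_abs.1 (show x ≤ |S ω| from hω) with h | h
        · exact Or.inl h
        · exact Or.inr (show S ω ≤ -x by linarith)
    _ ≤ P.real {ω | x ≤ S ω} + P.real {ω | S ω ≤ -x} := measureReal_union_le _ _
    _ ≤ Real.exp (-(t * x) + c) + Real.exp (-(t * x) + c) := by
        refine add_le_add (h1.trans (Real.exp_le_exp.2 ?_)) (h2.trans (Real.exp_le_exp.2 ?_))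
        <;> linarith
    _ = _ := by ring

/-- Lower bound for the probability of a neighbourhood of `x` by exponential tilting and
Chebyshev's inequality. -/
lemma exp_cgf_le_measure_abs_sub_lt {S : Ω → ℝ} (hS : Measurable S) {t x h : ℝ} (hh : 0 < h)
    (ht : t ∈ interior (integrableExpSet S P)) (hmean : |deriv (cgf S P) t - x| ≤ h / 2)
    (hvar : iteratedDeriv 2 (cgf S P) t ≤ h ^ 2 / 8) :
    ENNReal.ofReal (1 / 2 * Real.exp (cgf S P t - t * x - |t| * h)) ≤
      P {ω | |S ω - x| < h} := by
  set Q := P.tilted (fun ω => t * S ω) with hQ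
  have htm : t ∈ integrableExpSet S P := interior_subset ht
  have hint : Integrable (fun ω => Real.exp (t * S ω)) P := htm
  have : IsProbabilityMeasure Q := isProbabilityMeasure_tilted hint
  set E := {ω | |S ω - x| < h} with hE
  have hEm : MeasurableSet E :=
    measurableSet_lt (by fun_prop) measurable_const
  -- Under the tilted law, `S` has mean and variance equal to the first two derivatives of the cgf
  -- at t. Chebyshev at distance h/2 then gives (h²/8)/(h/2)² = 1/2.
  have hcheb : Q Eᶜ ≤ ENNReal.ofReal (1 / 2) := by
    have hL : MemLp S 2 Q := memLp_tilted_mul ht 2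
    have hc := meas_ge_le_variance_div_sq hL (half_pos hh)
    rw [integral_tilted_mul_self ht, variance_tilted_mul ht] at hc
    refine (measure_mono fun ω hω => ?_).trans (hc.trans (ENNReal.ofReal_le_ofReal ?_))
    · have h1 : h ≤ |S ω - x| := not_lt.1 hω
      have h2 : |S ω - x| ≤ |S ω - deriv (cgf S P) t| + |deriv (cgf S P) t - x| :=
        abs_sub_le _ _ _
      show h / 2 ≤ |S ω - deriv (cgf S P) t|
      linarith
    · rw [div_le_iff₀ (by positivity)]
      linarith
  have hQE : ENNReal.ofReal (1 / 2) ≤ Q E := by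
    have h1 : Q E + Q Eᶜ = 1 := by rw [measure_add_measure_compl hEm, measure_univ]
    have h2 : (1 : ℝ≥0∞) ≤ Q E + ENNReal.ofReal (1 / 2) := h1 ▸ by gcongr
    have h3 : (1 : ℝ≥0∞) = ENNReal.ofReal (1 / 2) + ENNReal.ofReal (1 / 2) := by
      rw [← ENNReal.ofReal_add (by norm_num) (by norm_num)]; norm_num
    rw [h3] at h2
    exact (ENNReal.add_le_add_iff_right ENNReal.ofReal_ne_top).1 h2
  have hub : Q E ≤ ENNReal.ofReal (Real.exp (t * x + |t| * h - cgf S P t)) * P E := by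
    rw [hQ, tilted_mul_apply_cgf' hEm hint, ← setLIntegral_const]
    refine setLIntegral_mono measurable_const fun ω hω => ?_
    refine ENNReal.ofReal_le_ofReal (Real.exp_le_exp.2 ?_)
    have h1 : t * (S ω - x) ≤ |t| * h :=
      (le_abs_self _).trans (by
        rw [abs_mul]; exact mul_le_mul_of_nonneg_left (le_of_lt hω) (abs_nonneg _))
    linarith
  calc ENNReal.ofReal (1 / 2 * Real.exp (cgf S P t - t * x - |t| * h))
      = ENNReal.ofReal (Real.exp (cgf S P t - t * x - |t| * h)) * ENNReal.ofReal (1 / 2) := by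
        rw [mul_comm, ENNReal.ofReal_mul (Real.exp_pos _).le]
    _ ≤ ENNReal.ofReal (Real.exp (cgf S P t - t * x - |t| * h)) *
        (ENNReal.ofReal (Real.exp (t * x + |t| * h - cgf S P t)) * P E) := by
        gcongr; exact hQE.trans hub
    _ = P E := by
        rw [← mul_assoc, ← ENNReal.ofReal_mul (Real.exp_pos _).le, ← Real.exp_add]
        ring_nf
        simp

/-- Second order behaviour at the origin of the cumulant generating function of a standardised
random variable. -/
lemma eventually_cgf_near_zero {Y : Ω → ℝ} (h0 : 0 ∈ interior (integrableExpSet Y P))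
    (hmean : ∫ ω, Y ω ∂P = 0) (hvar : variance Y P = 1) {ε : ℝ} (hε : 0 < ε) :
    ∀ᶠ t in 𝓝 (0 : ℝ), t ∈ interior (integrableExpSet Y P) ∧
      |cgf Y P t - t ^ 2 / 2| ≤ ε * t ^ 2 ∧ |deriv (cgf Y P) t - t| ≤ ε * |t| ∧
      iteratedDeriv 2 (cgf Y P) t ≤ 2 := by
  have han := analyticAt_cgf h0
  have hd0 : deriv (cgf Y P) 0 = 0 := by rw [deriv_cgf_zero h0, hmean, zero_div]
  have hd2 : iteratedDeriv 2 (cgf Y P) 0 = 1 := by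
    rw [← variance_tilted_mul h0]; simpa using hvar
  have hd2' : deriv (deriv (cgf Y P)) 0 = 1 := by
    rwa [iteratedDeriv_succ, iteratedDeriv_one] at hd2
  have hder : HasDerivAt (deriv (cgf Y P)) 1 0 := hd2' ▸ han.deriv.differentiableAt.hasDerivAt
  have h1 : ∀ᶠ t in 𝓝 (0 : ℝ), |deriv (cgf Y P) t - t| ≤ ε * |t| := by
    have := (hasDerivAt_iff_isLittleO.1 hder).def hε
    simpa [hd0] using this
  have h2 : ∀ᶠ t in 𝓝 (0 : ℝ), iteratedDeriv 2 (cgf Y P) t ≤ 2 := by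
    have hcont : ContinuousAt (iteratedDeriv 2 (cgf Y P)) 0 := by
      rw [iteratedDeriv_succ, iteratedDeriv_one]
      exact han.deriv.deriv.continuousAt
    have : ∀ᶠ t in 𝓝 (0 : ℝ), iteratedDeriv 2 (cgf Y P) t < 2 :=
      hcont.eventually_lt_const (by rw [hd2]; norm_num)
    exact this.mono fun _ h => h.le
  have h3 : ∀ᶠ t in 𝓝 (0 : ℝ), t ∈ interior (integrableExpSet Y P) :=
    isOpen_interior.mem_nhds h0
  obtain ⟨δ, hδ, hball⟩ := Metric.eventually_nhds_iff_ball.1 (h1.and (h2.and h3))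
  filter_upwards [Metric.ball_mem_nhds 0 hδ] with t ht
  obtain ⟨ha, hb, hc⟩ := hball t ht
  refine ⟨hc, ?_, ha, hb⟩
  have hsub : ∀ u ∈ Set.uIcc 0 t, u ∈ Metric.ball (0 : ℝ) δ ∧ |u| ≤ |t| := by
    intro u hu
    have : |u| ≤ |t| := by simpa using Set.abs_sub_left_of_mem_uIcc hu
    refine ⟨?_, this⟩
    rw [mem_ball_zero_iff, Real.norm_eq_abs] at ht ⊢
    exact this.trans_lt ht
  -- The mean value inequality for cgf - u²/2 turns the derivative bound ε|t| on the segment into ε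
  -- t².
  have hmv := (convex_uIcc (0 : ℝ) t).norm_image_sub_le_of_norm_hasDerivWithin_le
    (f := fun u => cgf Y P u - u ^ 2 / 2) (f' := fun u => deriv (cgf Y P) u - u)
    (C := ε * |t|) (fun u hu => by
      have hu' := (hball u (hsub u hu).1).2.2
      have := ((analyticAt_cgf hu').differentiableAt.hasDerivAt.sub
        (((hasDerivAt_id u).pow 2).div_const 2)).hasDerivWithinAt (s := Set.uIcc 0 t)
      refine this.congr_deriv ?_
      simp) (fun u hu => by
      have := (hball u (hsub u hu).1).1
      rw [Real.norm_eq_abs]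
      exact this.trans (mul_le_mul_of_nonneg_left (hsub u hu).2 hε.le))
    Set.left_mem_uIcc Set.right_mem_uIcc
  have : |t| * |t| = t ^ 2 := by rw [← abs_mul, ← sq, abs_of_nonneg (sq_nonneg t)]
  simpa [cgf_zero, Real.norm_eq_abs, mul_assoc, this] using hmv

omit [IsProbabilityMeasure P] in
lemma cgf_sum_range {X : ℕ → Ω → ℝ} (hX : ∀ i, Measurable (X i)) (hindep : iIndepFun X P)
    (hident : ∀ i, IdentDistrib (X i) (X 0) P P) (m : ℕ) {t : ℝ}
    (ht : t ∈ integrableExpSet (X 0) P) :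
    cgf (fun ω => ∑ i ∈ Finset.range m, X i ω) P t = m * cgf (X 0) P t := by
  have hint : ∀ i, Integrable (fun ω => Real.exp (t * X i ω)) P := fun i =>
    ((hident i).comp (u := fun x => Real.exp (t * x)) (by fun_prop)).integrable_iff.2 ht
  have hfun : (fun ω => ∑ i ∈ Finset.range m, X i ω) = ∑ i ∈ Finset.range m, X i := by
    ext ω; simp
  rw [hfun, hindep.cgf_sum hX fun i _ => hint i]
  have : ∀ i, cgf (X i) P t = cgf (X 0) P t := fun i => by
    rw [cgf, cgf, mgf_congr_identDistrib (hident i)]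
  simp [this]

lemma integrableExpSet_sum_range {X : ℕ → Ω → ℝ} (hX : ∀ i, Measurable (X i))
    (hindep : iIndepFun X P) (hident : ∀ i, IdentDistrib (X i) (X 0) P P) (m : ℕ) :
    integrableExpSet (X 0) P ⊆ integrableExpSet (fun ω => ∑ i ∈ Finset.range m, X i ω) P := by
  intro t ht
  have hint : ∀ i, Integrable (fun ω => Real.exp (t * X i ω)) P := fun i =>
    ((hident i).comp (u := fun x => Real.exp (t * x)) (by fun_prop)).integrable_iff.2 ht
  have := hindep.integrable_exp_mul_sum hX (s := Finset.range m) fun i _ => hint i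
  simpa [integrableExpSet] using this

end SingleSum

section UniformBounds

variable {Ω : Type*} [MeasurableSpace Ω] {P : Measure Ω} [IsProbabilityMeasure P]
  {X : ℕ → Ω → ℝ} {a b r : ℕ → ℝ}

/-- Upper moderate deviation bound, uniform in the number of summands. -/
lemma eventually_measure_abs_sum_ge_le (hX : ∀ i, Measurable (X i)) (hindep : iIndepFun X P)
    (hident : ∀ i, IdentDistrib (X i) (X 0) P P)
    (h0 : 0 ∈ interior (integrableExpSet (X 0) P))
    (hmean : ∫ ω, X 0 ω ∂P = 0) (hvar : variance (X 0) P = 1)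
    (hab : ∀ᶠ k in atTop, 0 < a k ∧ 0 < b k ∧ a k ^ 2 = r k * b k)
    (hlim : Tendsto (fun k => a k / b k) atTop (𝓝 0))
    {y s ε : ℝ} (hy : 0 ≤ y) (hs : 0 < s) (hε : 0 < ε) :
    ∀ᶠ k in atTop, ∀ m : ℕ, (m : ℝ) ≤ s * b k →
      P {ω | y * a k ≤ |∑ i ∈ Finset.range m, X i ω|} ≤
        ENNReal.ofReal (2 * Real.exp (-(r k * (y ^ 2 / (2 * (1 + ε) * s))))) := by
  -- This tilt minimises -t y a + s b (1+ε) t²/2; the minimum is -r y²/(2(1+ε)s).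
  have ht : Tendsto (fun k => y / ((1 + ε) * s) * (a k / b k)) atTop (𝓝 0) := by
    simpa using hlim.const_mul (y / ((1 + ε) * s))
  have ht' : Tendsto (fun k => -(y / ((1 + ε) * s) * (a k / b k))) atTop (𝓝 0) := by
    simpa using ht.neg
  have hcgf := eventually_cgf_near_zero h0 hmean hvar (half_pos hε)
  filter_upwards [hab, ht.eventually hcgf, ht'.eventually hcgf] with k ⟨ha, hb, hr⟩ h1 h2 m hm
  set t := y / ((1 + ε) * s) * (a k / b k) with htdef
  have ht0 : 0 ≤ t := by positivity
  have hsub := integrableExpSet_sum_range hX hindep hident m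
  have hexp : ∀ u ∈ integrableExpSet (X 0) P, u ^ 2 = t ^ 2 →
      |cgf (X 0) P u - u ^ 2 / 2| ≤ ε / 2 * u ^ 2 →
      cgf (fun ω => ∑ i ∈ Finset.range m, X i ω) P u ≤ s * b k * ((1 + ε) / 2 * t ^ 2) := by
    intro u hu hut hub
    rw [cgf_sum_range hX hindep hident m hu]
    rw [hut] at hub
    have h3 : cgf (X 0) P u ≤ (1 + ε) / 2 * t ^ 2 := by
      linarith [(abs_le.1 hub).2]
    calc (m : ℝ) * cgf (X 0) P u ≤ m * ((1 + ε) / 2 * t ^ 2) := by gcongr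
      _ ≤ _ := by gcongr
  have hm1 : t ∈ integrableExpSet (X 0) P := interior_subset h1.1
  have hm2 : -t ∈ integrableExpSet (X 0) P := interior_subset h2.1
  refine (measure_abs_ge_le_exp_cgf ht0 (hsub hm1) (hsub hm2) (hexp t hm1 rfl h1.2.1)
    (hexp (-t) hm2 (by ring) h2.2.1)).trans (le_of_eq ?_)
  congr 3
  have hrk : r k = a k ^ 2 / b k := by rw [hr]; field_simp
  rw [hrk, htdef]
  field_simp
  ring

/-- Lower moderate deviation bound, uniform in the number of summands. -/
lemma exists_eventually_le_measure_abs_sum_sub_lt (hX : ∀ i, Measurable (X i))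
    (hindep : iIndepFun X P) (hident : ∀ i, IdentDistrib (X i) (X 0) P P)
    (h0 : 0 ∈ interior (integrableExpSet (X 0) P))
    (hmean : ∫ ω, X 0 ω ∂P = 0) (hvar : variance (X 0) P = 1)
    (hr : Tendsto r atTop atTop)
    (hab : ∀ᶠ k in atTop, 0 < a k ∧ 0 < b k ∧ a k ^ 2 = r k * b k)
    (hlim : Tendsto (fun k => a k / b k) atTop (𝓝 0))
    {y s c η : ℝ} (hs : 0 < s) (hη : 0 < η) (hc : y ^ 2 / (2 * s) < c) :
    ∃ δ > 0, ∀ᶠ k in atTop, ∀ m : ℕ, |m / b k - s| < δ →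
      ENNReal.ofReal (1 / 2 * Real.exp (-(r k * c))) ≤
        P {ω | |∑ i ∈ Finset.range m, X i ω - y * a k| < η * a k} := by
  -- A single e serves as index window and as relative width of the target interval; at e = 0 the
  -- exponent is y²/(2s).
  obtain ⟨e, he0, heη, hes, hec⟩ : ∃ e : ℝ, 0 < e ∧ e < η ∧ e < s / 2 ∧
      (y ^ 2 * (1 / 2 + e) + |y| * e) / (s - e) < c := by
    have hcont : ContinuousAt (fun e : ℝ => (y ^ 2 * (1 / 2 + e) + |y| * e) / (s - e)) 0 := by
      refine ContinuousAt.div (by fun_prop) (by fun_prop) ?_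
      simpa using hs.ne'
    have h1 : ∀ᶠ e in 𝓝[>] (0 : ℝ), (y ^ 2 * (1 / 2 + e) + |y| * e) / (s - e) < c := by
      refine (hcont.eventually_lt_const ?_).filter_mono nhdsWithin_le_nhds
      refine lt_of_eq_of_lt ?_ hc
      simp only [add_zero, mul_zero, sub_zero]
      field_simp
    obtain ⟨e, he, ⟨hpos, hlt⟩⟩ :=
      (h1.and (Ioo_mem_nhdsGT (lt_min hη (half_pos hs)))).exists
    exact ⟨e, hpos, hlt.trans_le (min_le_left _ _), hlt.trans_le (min_le_right _ _), he⟩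
  obtain ⟨ε, hε0, hεe, hεy⟩ : ∃ ε : ℝ, 0 < ε ∧ ε ≤ e ∧ ε * |y| ≤ e / 2 := by
    refine ⟨min e (e / 2 / (|y| + 1)), by positivity, min_le_left _ _, ?_⟩
    calc min e (e / 2 / (|y| + 1)) * |y| ≤ e / 2 / (|y| + 1) * (|y| + 1) := by
          gcongr
          · exact min_le_right _ _
          · linarith
      _ = e / 2 := by field_simp
  obtain ⟨τ, hτ, hball⟩ := Metric.eventually_nhds_iff_ball.1
    (eventually_cgf_near_zero h0 hmean hvar hε0)
  have hlim' : Tendsto (fun k => |y| / (s / 2) * (a k / b k)) atTop (𝓝 0) := by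
    simpa using hlim.const_mul (|y| / (s / 2))
  refine ⟨e, he0, ?_⟩
  -- The constant 32 comes from the variance: at most 2m ≤ 4 s b, which must not exceed (e a)²/8 = r
  -- e² b/8.
  filter_upwards [hab, hlim'.eventually_lt_const hτ, hr.eventually_ge_atTop (32 * s / e ^ 2)]
    with k ⟨ha, hb, hrk⟩ hsmall hrbig m hm
  obtain ⟨hm1, hm2⟩ := abs_lt.1 hm
  have hlow : (s - e) * b k ≤ m := by
    rw [← le_div_iff₀ hb]; linarith
  have hup : (m : ℝ) ≤ 2 * s * b k := by
    rw [← div_le_iff₀ hb]; linarith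
  have hse : 0 < s - e := by linarith
  have hmpos : (0 : ℝ) < m := lt_of_lt_of_le (by positivity) hlow
  -- The Gaussian tilt, for which the tilted mean is m θ = y a to first order.
  set θ := y * a k / m with hθ
  have hθa : |θ| = |y| * a k / m := by
    rw [hθ, abs_div, abs_mul, abs_of_pos ha, abs_of_pos hmpos]
  have hmθ : m * θ = y * a k := by rw [hθ]; field_simp
  have hθτ : θ ∈ Metric.ball (0 : ℝ) τ := by
    rw [mem_ball_zero_iff, Real.norm_eq_abs, hθa]
    refine lt_of_le_of_lt ?_ hsmall
    calc |y| * a k / m ≤ |y| * a k / (s / 2 * b k) := by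
          gcongr
          refine le_trans ?_ hlow
          gcongr
          linarith
      _ = _ := by field_simp
  obtain ⟨hθi, hθ0, hθ1, hθ2⟩ := hball θ hθτ
  set S : Ω → ℝ := fun ω => ∑ i ∈ Finset.range m, X i ω with hS
  have hSm : Measurable S := Finset.measurable_sum _ fun i _ => hX i
  have hsub := integrableExpSet_sum_range hX hindep hident m
  have hmem : θ ∈ integrableExpSet (X 0) P := interior_subset hθi
  have hcgfeq : cgf S P =ᶠ[𝓝 θ] fun t => m * cgf (X 0) P t := by
    filter_upwards [isOpen_interior.mem_nhds hθi] with t ht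
    exact cgf_sum_range hX hindep hident m (interior_subset ht)
  have han := analyticAt_cgf hθi
  have hder : deriv (cgf S P) θ = m * deriv (cgf (X 0) P) θ := by
    rw [hcgfeq.deriv_eq, deriv_const_mul _ han.differentiableAt]
  have hder2 : iteratedDeriv 2 (cgf S P) θ = m * iteratedDeriv 2 (cgf (X 0) P) θ := by
    rw [hcgfeq.iteratedDeriv_eq, iteratedDeriv_const_mul_field]
  have key := exp_cgf_le_measure_abs_sub_lt (P := P) hSm (t := θ) (x := y * a k) (h := e * a k)
    (by positivity) (interior_mono hsub hθi) ?_ ?_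
  · refine (ENNReal.ofReal_le_ofReal ?_).trans (key.trans (measure_mono fun ω hω => ?_))
    · gcongr
      rw [cgf_sum_range hX hindep hident m hmem]
      have h3 : m * ((1 / 2 - ε) * θ ^ 2) ≤ m * cgf (X 0) P θ := by
        gcongr
        linarith [(abs_le.1 hθ0).1]
      have h4 : m * ((1 / 2 - ε) * θ ^ 2) - θ * (y * a k) - |θ| * (e * a k) =
          -(a k ^ 2 / m * (y ^ 2 * (1 / 2 + ε) + |y| * e)) := by
        rw [hθa, hθ]
        field_simp
        ring
      have h5 : a k ^ 2 / m ≤ r k / (s - e) := by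
        rw [div_le_div_iff₀ hmpos hse, hrk]
        have hrpos : 0 ≤ r k := le_trans (by positivity) hrbig
        nlinarith [mul_le_mul_of_nonneg_left hlow hrpos]
      have hrpos : 0 ≤ r k := le_trans (by positivity) hrbig
      have h6 : a k ^ 2 / m * (y ^ 2 * (1 / 2 + ε) + |y| * e) ≤ r k * c := by
        calc a k ^ 2 / m * (y ^ 2 * (1 / 2 + ε) + |y| * e)
            ≤ r k / (s - e) * (y ^ 2 * (1 / 2 + e) + |y| * e) := by gcongr
          _ = r k * ((y ^ 2 * (1 / 2 + e) + |y| * e) / (s - e)) := by ring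
          _ ≤ r k * c := by gcongr
      linarith
    · have h8 : |S ω - y * a k| < e * a k := hω
      exact h8.trans (by gcongr)
  · rw [hder, ← hmθ, ← mul_sub, abs_mul, abs_of_pos hmpos]
    calc m * |deriv (cgf (X 0) P) θ - θ| ≤ m * (ε * |θ|) := by gcongr
      _ = ε * |y| * a k := by rw [hθa]; field_simp
      _ ≤ e / 2 * a k := by gcongr
      _ = e * a k / 2 := by ring
  · rw [hder2]
    have h7 : 32 * s ≤ r k * e ^ 2 := (div_le_iff₀ (by positivity)).1 hrbig
    calc m * iteratedDeriv 2 (cgf (X 0) P) θ ≤ m * 2 := by gcongr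
      _ ≤ 2 * s * b k * 2 := by gcongr
      _ = 32 * s * b k / 8 := by ring
      _ ≤ r k * e ^ 2 * b k / 8 := by gcongr
      _ = (e * a k) ^ 2 / 8 := by rw [mul_pow, hrk]; ring

end UniformBounds

/-! ### Randomly indexed sequences -/

section RandomIndex

variable {Ω E : Type*} [MeasurableSpace Ω] [MeasurableSpace E] {P : Measure Ω}
  {N : Ω → ℕ} {S : ℕ → Ω → E}

lemma measure_randomIndex_eq_tsum (hN : Measurable N) (hS : ∀ m, Measurable (S m))
    (hNS : ∀ m, IndepFun N (S m) P) (A : Set ℕ) {B : Set E} (hB : MeasurableSet B) :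
    P {ω | N ω ∈ A ∧ S (N ω) ω ∈ B} = ∑' m : A, P (N ⁻¹' {(m : ℕ)}) * P (S m ⁻¹' B) := by
  have hset : {ω | N ω ∈ A ∧ S (N ω) ω ∈ B} = ⋃ m ∈ A, N ⁻¹' {m} ∩ S m ⁻¹' B := by
    ext ω; simp
  rw [hset, measure_biUnion A.to_countable]
  · refine tsum_congr fun m => ?_
    exact (hNS m).measure_inter_preimage_eq_mul _ _ (measurableSet_singleton _) hB
  · intro m _ n _ hmn
    refine Set.disjoint_left.2 fun ω h1 h2 => hmn ?_
    rw [← show N ω = m from h1.1, ← show N ω = n from h2.1]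
  · exact fun m _ => (hN (measurableSet_singleton _)).inter (hS m hB)

lemma measure_index_eq_tsum (hN : Measurable N) (A : Set ℕ) :
    P {ω | N ω ∈ A} = ∑' m : A, P (N ⁻¹' {(m : ℕ)}) := by
  have hset : {ω | N ω ∈ A} = ⋃ m ∈ A, N ⁻¹' {m} := by ext ω; simp
  rw [hset, measure_biUnion A.to_countable]
  · intro m _ n _ hmn
    refine Set.disjoint_left.2 fun ω h1 h2 => hmn ?_
    rw [← show N ω = m from h1, ← show N ω = n from h2]
  · exact fun m _ => hN (measurableSet_singleton _)

lemma measure_randomIndex_le (hN : Measurable N) (hS : ∀ m, Measurable (S m))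
    (hNS : ∀ m, IndepFun N (S m) P) {A : Set ℕ} {B : Set E} (hB : MeasurableSet B) {q : ℝ≥0∞}
    (h : ∀ m ∈ A, P (S m ⁻¹' B) ≤ q) :
    P {ω | N ω ∈ A ∧ S (N ω) ω ∈ B} ≤ P {ω | N ω ∈ A} * q := by
  rw [measure_randomIndex_eq_tsum hN hS hNS A hB, measure_index_eq_tsum hN, ← ENNReal.tsum_mul_right]
  exact ENNReal.tsum_le_tsum fun m => by gcongr; exact h m m.2

lemma le_measure_randomIndex (hN : Measurable N) (hS : ∀ m, Measurable (S m))
    (hNS : ∀ m, IndepFun N (S m) P) {A : Set ℕ} {B : Set E} (hB : MeasurableSet B) {q : ℝ≥0∞}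
    (h : ∀ m ∈ A, q ≤ P (S m ⁻¹' B)) :
    P {ω | N ω ∈ A} * q ≤ P {ω | N ω ∈ A ∧ S (N ω) ω ∈ B} := by
  rw [measure_randomIndex_eq_tsum hN hS hNS A hB, measure_index_eq_tsum hN, ← ENNReal.tsum_mul_right]
  exact ENNReal.tsum_le_tsum fun m => by gcongr; exact h m m.2

end RandomIndex

/-! ### The mixed rate function -/

section Rate

variable {I : ℝ → ℝ≥0∞}

lemma lowerSemicontinuous_of_isCompact_level
    (h : ∀ L : ℝ≥0, IsCompact {x : ℝ | I x ≤ (L : ℝ≥0∞)}) : LowerSemicontinuous I := by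
  refine lowerSemicontinuous_iff_isClosed_preimage.2 fun L => ?_
  rcases eq_or_ne L ∞ with rfl | hL
  · simp
  · lift L to ℝ≥0 using hL
    exact (h L).isClosed

lemma mixedRate_le {s : ℝ} (hs : 0 < s) (y : ℝ) :
    mixedRate I y ≤ ENNReal.ofReal (y ^ 2 / (2 * s)) + I s :=
  iInf₂_le s hs

lemma mixedRate_lt_iff {y : ℝ} {L : ℝ≥0∞} :
    mixedRate I y < L ↔ ∃ s : ℝ, 0 < s ∧ ENNReal.ofReal (y ^ 2 / (2 * s)) + I s < L := by
  simp [mixedRate, iInf_lt_iff]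

lemma mixedRate_mono_abs {y z : ℝ} (h : |y| ≤ |z|) : mixedRate I y ≤ mixedRate I z := by
  refine le_iInf₂ fun s hs => (mixedRate_le hs y).trans ?_
  have hs' : (0 : ℝ) < s := hs
  have := sq_le_sq.2 h
  gcongr

/-- On the segment from 0 to a point s of finite rate, I(ts) ≤ (1-t) I(0) + t I(s), and the right
side tends to I(0) as t ↓ 0. No continuity of I at 0 is needed. -/
lemma mixedRate_zero_le (hconv : ConvexOn ℝ≥0 Set.univ I) (hfin : ∃ s : ℝ, 0 < s ∧ I s ≠ ∞) :
    mixedRate I 0 ≤ I 0 := by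
  obtain ⟨s, hs, hsI⟩ := hfin
  have hlim : Tendsto (fun t : ℝ≥0 => I 0 + (t : ℝ≥0∞) * I s) (𝓝[>] 0) (𝓝 (I 0 + 0 * I s)) := by
    refine tendsto_const_nhds.add (ENNReal.Tendsto.mul_const ?_ (Or.inr hsI))
    exact (ENNReal.tendsto_coe.2 tendsto_id).mono_left nhdsWithin_le_nhds
  rw [zero_mul, add_zero] at hlim
  refine ge_of_tendsto hlim ?_
  filter_upwards [Ioo_mem_nhdsGT (zero_lt_one' ℝ≥0)] with t ht
  have h0 : (0 : ℝ) < t * s := mul_pos (by exact_mod_cast ht.1) hs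
  refine (mixedRate_le h0 0).trans ?_
  have := hconv.2 (Set.mem_univ 0) (Set.mem_univ s) (zero_le (a := 1 - t)) (zero_le (a := t))
    (tsub_add_cancel_of_le ht.2.le)
  simp only [smul_zero, zero_add, NNReal.smul_def, smul_eq_mul, ENNReal.smul_def] at this
  simp only [ne_eq, OfNat.ofNat_ne_zero, not_false_eq_true, zero_pow, zero_div,
    ENNReal.ofReal_zero, zero_add]
  refine this.trans ?_
  gcongr
  refine mul_le_of_le_one_left' ?_
  exact_mod_cast tsub_le_self

/-- Sublevel sets of the mixed rate function are sandwiched between compact sets. -/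
lemma exists_isCompact_mixedRate (hlsc : LowerSemicontinuous I)
    (hconv : ConvexOn ℝ≥0 Set.univ I) (hlim : Tendsto I atTop (𝓝 ∞))
    (hfin : ∃ s : ℝ, 0 < s ∧ I s ≠ ∞) (L : ℝ≥0) :
    ∃ K : Set ℝ, IsCompact K ∧ (∀ y, mixedRate I y < L → y ∈ K) ∧ ∀ y ∈ K, mixedRate I y ≤ L := by
  obtain ⟨M, hM⟩ := eventually_atTop.1 (hlim.eventually_const_lt (ENNReal.coe_lt_top (r := L)))
  set R : ℝ := 2 * M * L + 1
  -- The coordinates are y, s and a budget c for y²/(2s). Writing the constraint as y² ≤ 2sc keeps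
  -- it closed at s = 0, where it forces y = 0.
  set D : Set (ℝ × ℝ × ℝ) := (Set.Icc (-R) R ×ˢ Set.Icc 0 M ×ˢ Set.Icc 0 (L : ℝ)) ∩
    ({q | q.1 ^ 2 ≤ 2 * q.2.1 * q.2.2} ∩
      {q | I q.2.1 + ENNReal.ofReal q.2.2 ≤ L}) with hD
  have hDc : IsCompact D := by
    refine (isCompact_Icc.prod (isCompact_Icc.prod isCompact_Icc)).inter_right
      (IsClosed.inter ?_ ?_)
    · exact isClosed_le (by fun_prop) (by fun_prop)
    · have h1 : LowerSemicontinuous fun q : ℝ × ℝ × ℝ => I q.2.1 :=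
        hlsc.comp (g := fun q : ℝ × ℝ × ℝ => q.2.1) (by fun_prop)
      have h2 : LowerSemicontinuous fun q : ℝ × ℝ × ℝ => ENNReal.ofReal q.2.2 :=
        Continuous.lowerSemicontinuous (ENNReal.continuous_ofReal.comp (by fun_prop))
      exact (h1.add h2).isClosed_preimage _
  refine ⟨Prod.fst '' D, hDc.image continuous_fst, fun y hy => ?_, ?_⟩
  · obtain ⟨s, hs, hsL⟩ := mixedRate_lt_iff.1 hy
    have hsM : s ≤ M := by
      by_contra hcon
      exact absurd (hM s (not_le.1 hcon).le) (not_lt.2 (le_add_self.trans hsL.le))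
    have hcL : y ^ 2 / (2 * s) ≤ L := by
      have := le_self_add.trans hsL.le
      rwa [ENNReal.ofReal_le_iff_le_toReal ENNReal.coe_ne_top] at this
    have hyc : y ^ 2 = 2 * s * (y ^ 2 / (2 * s)) := by field_simp
    have hyM : y ^ 2 ≤ 2 * M * L := by
      rw [hyc]
      have : (0 : ℝ) ≤ M := hs.le.trans hsM
      gcongr
    refine ⟨(y, s, y ^ 2 / (2 * s)), ⟨⟨?_, ⟨hs.le, hsM⟩, by positivity, hcL⟩, hyc.le, ?_⟩, rfl⟩
    · refine abs_le.1 (abs_le_of_sq_le_sq ?_ ?_) <;> nlinarith [sq_nonneg y]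
    · rw [Set.mem_ofPred_eq, add_comm]; exact hsL.le
  · rintro _ ⟨⟨y, s, c⟩, ⟨⟨_, ⟨hs0, _⟩, hc0, _⟩, hy, hI⟩, rfl⟩
    simp only [Set.mem_ofPred_eq] at hs0 hc0 hy hI ⊢
    rcases hs0.eq_or_lt with rfl | hs
    · have hy0 : y = 0 := by
        have : y ^ 2 ≤ 0 := by simpa using hy
        exact pow_eq_zero_iff (two_ne_zero) |>.1 (le_antisymm this (sq_nonneg y))
      rw [hy0]
      exact (mixedRate_zero_le hconv hfin).trans (le_self_add.trans hI)
    · refine (mixedRate_le hs y).trans (le_trans ?_ hI)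
      rw [add_comm]
      gcongr
      rw [div_le_iff₀ (by positivity)]
      linarith

/-- Only strict sublevels supply an actual s, so the level set is recovered as the intersection of
the compact sets over all L' > L. -/
lemma isCompact_mixedRate_level (hlsc : LowerSemicontinuous I)
    (hconv : ConvexOn ℝ≥0 Set.univ I) (hlim : Tendsto I atTop (𝓝 ∞))
    (hfin : ∃ s : ℝ, 0 < s ∧ I s ≠ ∞) (L : ℝ≥0) :
    IsCompact {y : ℝ | mixedRate I y ≤ (L : ℝ≥0∞)} := by
  choose K hK hsub hsup using exists_isCompact_mixedRate hlsc hconv hlim hfin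
  have heq : {y : ℝ | mixedRate I y ≤ (L : ℝ≥0∞)} = ⋂ L' ∈ Set.Ioi L, K L' := by
    ext y
    simp only [Set.mem_ofPred_eq, Set.mem_iInter, Set.mem_Ioi]
    refine ⟨fun h L' hL' => hsub L' y (h.trans_lt (by exact_mod_cast hL')), fun h => ?_⟩
    refine ENNReal.le_of_forall_pos_le_add fun ε hε _ => ?_
    exact_mod_cast hsup _ y (h (L + ε) (lt_add_of_pos_right L hε))
  rw [heq]
  refine (hK (L + 1)).of_isClosed_subset (isClosed_biInter fun L' _ => (hK L').isClosed) ?_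
  exact Set.biInter_subset_of_mem (lt_add_of_pos_right L one_pos)

end Rate

/-! ### Transfer of the large deviation principle -/

lemma ereal_lt_iInf {I : ℝ → ℝ≥0∞} {U : Set ℝ} {c d : ℝ} (hcd : c < d)
    (h : ∀ x ∈ U, (d : EReal) ≤ I x) : (c : EReal) < ((⨅ x ∈ U, I x : ℝ≥0∞) : EReal) := by
  have h1 : ENNReal.ofReal d ≤ ⨅ x ∈ U, I x := by
    refine le_iInf₂ fun x hx => ?_
    rw [← EReal.coe_ennreal_le_coe_ennreal_iff, EReal.coe_ennreal_ofReal]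
    rcases max_choice d 0 with h' | h'
    · rw [h']; exact h x hx
    · rw [h']; exact EReal.coe_ennreal_nonneg _
  refine lt_of_lt_of_le ?_ (EReal.coe_ennreal_le_coe_ennreal_iff.2 h1)
  rw [EReal.coe_ennreal_ofReal, EReal.coe_lt_coe_iff]
  exact hcd.trans_le (le_max_left _ _)

/-- Splitting a level below the mixed rate function into a Gaussian and an index contribution. -/
lemma exists_split_of_lt_mixedRate {I : ℝ → ℝ≥0∞} (hconv : ConvexOn ℝ≥0 Set.univ I)
    (hfin : ∃ s : ℝ, 0 < s ∧ I s ≠ ∞) {y c s : ℝ} (hy : 0 ≤ y) (hs : 0 ≤ s)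
    (hc : (c : EReal) < mixedRate I y) :
    ∃ s' ε c₂ : ℝ, s < s' ∧ 0 < ε ∧ (c₂ : EReal) < I s ∧
      c ≤ y ^ 2 / (2 * (1 + ε) * s') + c₂ := by
  rcases hs.eq_or_lt with rfl | hs
  · rcases hy.eq_or_lt with rfl | hy
    · refine ⟨1, 1, c, one_pos, one_pos, hc.trans_le ?_, by simp⟩
      exact EReal.coe_ennreal_le_coe_ennreal_iff.2 (mixedRate_zero_le hconv hfin)
    -- With s' this small the Gaussian term alone is |c| + 1, so for the index I ≥ 0 > -1 is enough.
    · refine ⟨y ^ 2 / (4 * (|c| + 1)), 1, -1, by positivity, one_pos, ?_, ?_⟩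
      · refine lt_of_lt_of_le ?_ (EReal.coe_ennreal_nonneg _)
        exact_mod_cast neg_one_lt_zero (R := ℝ)
      · have : y ^ 2 / (2 * (1 + 1) * (y ^ 2 / (4 * (|c| + 1)))) = |c| + 1 := by
          field_simp
          norm_num
        rw [this]
        linarith [le_abs_self c]
  -- For s > 0, c₂ is chosen strictly above c - y²/(2s), and continuity leaves room to enlarge s and
  -- the factor 1+ε.
  · have h1 : ((c - y ^ 2 / (2 * s) : ℝ) : EReal) < I s := by
      rcases eq_or_ne (I s) ∞ with htop | htop
      · rw [htop]; exact EReal.coe_lt_top _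
      · have h2 : (c : EReal) < ((ENNReal.ofReal (y ^ 2 / (2 * s)) + I s : ℝ≥0∞) : EReal) :=
          hc.trans_le (EReal.coe_ennreal_le_coe_ennreal_iff.2 (mixedRate_le hs y))
        rw [← ENNReal.ofReal_toReal htop] at h2 ⊢
        rw [← ENNReal.ofReal_add (by positivity) ENNReal.toReal_nonneg, EReal.coe_ennreal_ofReal,
          max_eq_left (by positivity), EReal.coe_lt_coe_iff] at h2
        rw [EReal.coe_ennreal_ofReal, max_eq_left ENNReal.toReal_nonneg, EReal.coe_lt_coe_iff]
        linarith
    obtain ⟨c₂, hc₂, hc₂I⟩ := EReal.lt_iff_exists_real_btwn.1 h1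
    rw [EReal.coe_lt_coe_iff] at hc₂
    have hcont : ContinuousAt (fun e : ℝ => y ^ 2 / (2 * (1 + e) * (s + e))) 0 := by
      refine ContinuousAt.div (by fun_prop) (by fun_prop) ?_
      simpa using hs.ne'
    have h3 : ∀ᶠ e in 𝓝[>] (0 : ℝ), c - c₂ < y ^ 2 / (2 * (1 + e) * (s + e)) := by
      refine (hcont.eventually_const_lt ?_).filter_mono nhdsWithin_le_nhds
      simp only [add_zero, mul_one]
      linarith
    obtain ⟨e, he, he0⟩ := (h3.and self_mem_nhdsWithin).exists
    have he0' : (0 : ℝ) < e := he0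
    exact ⟨s + e, e, c₂, by linarith, he0', hc₂I, by linarith⟩

section Transfer

variable {Ω : Type*} [MeasurableSpace Ω] {P : Measure Ω} [IsProbabilityMeasure P]
  {X : ℕ → Ω → ℝ} {ν : ℕ → Ω → ℕ} {a b r : ℕ → ℝ} {I : ℝ → ℝ≥0∞}

lemma exists_eventually_measure_abs_randomSum_ge_le (hX : ∀ i, Measurable (X i))
    (hindep : iIndepFun X P) (hident : ∀ i, IdentDistrib (X i) (X 0) P P)
    (h0 : 0 ∈ interior (integrableExpSet (X 0) P))
    (hmean : ∫ ω, X 0 ω ∂P = 0) (hvar : variance (X 0) P = 1)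
    (hν : ∀ k, Measurable (ν k))
    (hνS : ∀ k m, IndepFun (ν k) (fun ω => ∑ i ∈ Finset.range m, X i ω) P)
    (hab : ∀ᶠ k in atTop, 0 < a k ∧ 0 < b k ∧ a k ^ 2 = r k * b k)
    (hlim : Tendsto (fun k => a k / b k) atTop (𝓝 0))
    (hLDP : SatisfiesLDP P (fun k ω => (ν k ω : ℝ) / b k) r I)
    (hconv : ConvexOn ℝ≥0 Set.univ I) (hItop : Tendsto I atTop (𝓝 ∞))
    (hfin : ∃ s : ℝ, 0 < s ∧ I s ≠ ∞) {y c : ℝ} (hy : 0 ≤ y)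
    (hc : (c : EReal) < mixedRate I y) :
    ∃ C : ℝ, ∀ᶠ k in atTop, P {ω | y * a k ≤ |∑ i ∈ Finset.range (ν k ω), X i ω|} ≤
      ENNReal.ofReal (C * Real.exp (-(r k * c))) := by
  have hr := hLDP.speed_tendsto
  have hclosed : ∀ (U : Set ℝ), IsClosed U → ∀ d : ℝ,
      (d : EReal) < ((⨅ x ∈ U, I x : ℝ≥0∞) : EReal) → ∀ᶠ k in atTop,
      P {ω | (ν k ω : ℝ) / b k ∈ U} ≤ ENNReal.ofReal (Real.exp (-(r k * d))) :=
    fun U hU d hd => eventually_le_exp_of_limsup_le hr (fun _ => measure_ne_top P _) hd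
      (hLDP.upper_bound U hU)
  have hlsc : LowerSemicontinuous fun x => (I x : EReal) :=
    continuous_coe_ennreal_ereal.comp_lowerSemicontinuous
      (lowerSemicontinuous_of_isCompact_level hLDP.isCompact_level)
      EReal.coe_ennreal_strictMono.monotone
  obtain ⟨M, hM⟩ := eventually_atTop.1
    (hItop.eventually_const_lt (ENNReal.ofReal_lt_top (r := c + 1)))
  have htail := hclosed (Set.Ici M) isClosed_Ici c <| ereal_lt_iInf (lt_add_one c) fun x hx => by
    refine le_trans ?_ (EReal.coe_ennreal_le_coe_ennreal_iff.2 (hM x hx).le)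
    rw [EReal.coe_ennreal_ofReal]
    exact_mod_cast le_max_left _ _
  have hcover : ∃ C : ℝ, 0 ≤ C ∧ ∀ᶠ k in atTop, P {ω | (ν k ω : ℝ) / b k ∈ Set.Icc 0 M ∧
      y * a k ≤ |∑ i ∈ Finset.range (ν k ω), X i ω|} ≤
      ENNReal.ofReal (C * Real.exp (-(r k * c))) := by
    -- Compactness induction: having such a bound passes to subsets and finite unions, so a
    -- neighbourhood of each s suffices.
    refine (isCompact_Icc (a := (0 : ℝ)) (b := M)).induction_on (p := fun U : Set ℝ => ∃ C : ℝ, 0 ≤ C ∧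
      ∀ᶠ k in atTop, P {ω | (ν k ω : ℝ) / b k ∈ U ∧
        y * a k ≤ |∑ i ∈ Finset.range (ν k ω), X i ω|} ≤
        ENNReal.ofReal (C * Real.exp (-(r k * c)))) ⟨0, le_rfl, by simp⟩ ?_ ?_ ?_
    · rintro U V hUV ⟨C, hC0, hC⟩
      refine ⟨C, hC0, hC.mono fun k hk => le_trans (measure_mono ?_) hk⟩
      exact fun ω hω => ⟨hUV hω.1, hω.2⟩
    · rintro U V ⟨C, hC0, hC⟩ ⟨C', hC0', hC'⟩
      refine ⟨C + C', add_nonneg hC0 hC0', ?_⟩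
      filter_upwards [hC, hC'] with k hk hk'
      rw [add_mul, ENNReal.ofReal_add (by positivity) (by positivity)]
      refine le_trans (measure_mono ?_) ((measure_union_le _ _).trans (add_le_add hk hk'))
      rintro ω ⟨h | h, h'⟩
      · exact Or.inl ⟨h, h'⟩
      · exact Or.inr ⟨h, h'⟩
    · intro s hs
      obtain ⟨s', ε, c₂, hss', hε, hc₂, hle⟩ :=
        exists_split_of_lt_mixedRate hconv hfin hy hs.1 hc
      obtain ⟨d, hcd, hdI⟩ := EReal.lt_iff_exists_real_btwn.1 hc₂
      rw [EReal.coe_lt_coe_iff] at hcd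
      -- On this ball lower semicontinuity keeps I above d, and every point stays below s', which
      -- bounds the number of summands.
      obtain ⟨δ, hδ, hball⟩ := Metric.nhds_basis_closedBall.mem_iff.1
        ((hlsc s d hdI).and (Iio_mem_nhds hss'))
      refine ⟨Metric.closedBall s δ, mem_nhdsWithin_of_mem_nhds (Metric.closedBall_mem_nhds s hδ),
        2, zero_le_two, ?_⟩
      have hup := eventually_measure_abs_sum_ge_le hX hindep hident h0 hmean hvar hab hlim
        hy (hs.1.trans_lt hss') hε
      have hidx := hclosed (Metric.closedBall s δ) Metric.isClosed_closedBall c₂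
        (ereal_lt_iInf hcd fun x hx => (hball hx).1.le)
      filter_upwards [hup, hidx, hab, hr.eventually_ge_atTop 0] with k hk1 hk2 ⟨_, hb, _⟩ hrk
      refine (measure_randomIndex_le (hν k) (S := fun m ω => ∑ i ∈ Finset.range m, X i ω)
        (fun m => Finset.measurable_sum _ fun i _ => hX i) (hνS k)
        (A := {m : ℕ | (m : ℝ) / b k ∈ Metric.closedBall s δ}) (B := {x | y * a k ≤ |x|})
        (measurableSet_le measurable_const (by fun_prop)) fun m hm => hk1 m ?_).trans ?_
      · rw [← div_le_iff₀ hb]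
        exact le_of_lt (hball hm).2
      · refine (mul_le_mul_left hk2 _).trans ?_
        rw [← ENNReal.ofReal_mul (Real.exp_pos _).le]
        refine ENNReal.ofReal_le_ofReal ?_
        rw [mul_left_comm, ← Real.exp_add]
        gcongr
        nlinarith [mul_le_mul_of_nonneg_left hle hrk]
  obtain ⟨C, hC0, hC⟩ := hcover
  refine ⟨C + 1, ?_⟩
  filter_upwards [hC, htail, hab] with k hk1 hk2 ⟨_, hb, _⟩
  rw [add_mul, one_mul, ENNReal.ofReal_add (by positivity) (Real.exp_pos _).le]
  refine le_trans (measure_mono fun ω hω => ?_) ((measure_union_le _ _).trans (add_le_add hk1 hk2))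
  rcases le_total ((ν k ω : ℝ) / b k) M with h | h
  · exact Or.inl ⟨⟨by positivity, h⟩, hω⟩
  · exact Or.inr h

lemma exists_eventually_le_measure_randomSum (hX : ∀ i, Measurable (X i))
    (hindep : iIndepFun X P) (hident : ∀ i, IdentDistrib (X i) (X 0) P P)
    (h0 : 0 ∈ interior (integrableExpSet (X 0) P))
    (hmean : ∫ ω, X 0 ω ∂P = 0) (hvar : variance (X 0) P = 1)
    (hν : ∀ k, Measurable (ν k))
    (hνS : ∀ k m, IndepFun (ν k) (fun ω => ∑ i ∈ Finset.range m, X i ω) P)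
    (hab : ∀ᶠ k in atTop, 0 < a k ∧ 0 < b k ∧ a k ^ 2 = r k * b k)
    (hlim : Tendsto (fun k => a k / b k) atTop (𝓝 0))
    (hLDP : SatisfiesLDP P (fun k ω => (ν k ω : ℝ) / b k) r I)
    {y c η : ℝ} (hη : 0 < η) (hc : (mixedRate I y : EReal) < c) :
    ∀ᶠ k in atTop, ENNReal.ofReal (1 / 2 * Real.exp (-(r k * c))) ≤
      P {ω | |∑ i ∈ Finset.range (ν k ω), X i ω - y * a k| < η * a k} := by
  have hr := hLDP.speed_tendsto
  have hc0 : 0 < c := by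
    have := (EReal.coe_ennreal_nonneg _).trans_lt hc
    exact_mod_cast this
  have hc' : mixedRate I y < ENNReal.ofReal c := by
    rwa [← EReal.coe_ennreal_lt_coe_ennreal_iff, EReal.coe_ennreal_ofReal, max_eq_left hc0.le]
  obtain ⟨s, hs, hsc⟩ := mixedRate_lt_iff.1 hc'
  have hItop : I s ≠ ∞ := (le_add_self.trans_lt (hsc.trans ENNReal.ofReal_lt_top)).ne
  rw [← ENNReal.ofReal_toReal hItop, ← ENNReal.ofReal_add (by positivity) ENNReal.toReal_nonneg,
    ENNReal.ofReal_lt_ofReal_iff hc0] at hsc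
  -- The slack at a near-optimal s, shared equally between the Gaussian and the index estimates.
  set g := c - (y ^ 2 / (2 * s) + (I s).toReal) with hg
  have hg0 : 0 < g := by linarith
  obtain ⟨δ, hδ, hlow⟩ := exists_eventually_le_measure_abs_sum_sub_lt hX hindep hident h0 hmean
    hvar hr hab hlim hs hη (lt_add_of_pos_right (y ^ 2 / (2 * s)) (half_pos hg0))
  have hidx : ∀ᶠ k in atTop, ENNReal.ofReal (Real.exp (-(r k * ((I s).toReal + g / 2)))) ≤
      P {ω | (ν k ω : ℝ) / b k ∈ Metric.ball s δ} := by
    refine eventually_exp_le_of_le_liminf hr (fun _ => measure_ne_top P _) ?_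
      (hLDP.lower_bound _ Metric.isOpen_ball)
    refine lt_of_le_of_lt (EReal.coe_ennreal_le_coe_ennreal_iff.2
      (iInf₂_le s (Metric.mem_ball_self hδ))) ?_
    rw [← ENNReal.ofReal_toReal hItop, EReal.coe_ennreal_ofReal,
      max_eq_left ENNReal.toReal_nonneg, EReal.coe_lt_coe_iff,
      ENNReal.toReal_ofReal ENNReal.toReal_nonneg]
    linarith
  filter_upwards [hlow, hidx] with k hk1 hk2
  have hmix := le_measure_randomIndex (hν k) (S := fun m ω => ∑ i ∈ Finset.range m, X i ω)
    (fun m => Finset.measurable_sum _ fun i _ => hX i) (hνS k)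
    (A := {m : ℕ | (m : ℝ) / b k ∈ Metric.ball s δ}) (B := {x | |x - y * a k| < η * a k})
    (measurableSet_lt (by fun_prop) measurable_const) fun m hm => hk1 m hm
  refine le_trans ?_ ((mul_le_mul_left hk2 _).trans (hmix.trans (measure_mono fun ω hω => hω.2)))
  rw [← ENNReal.ofReal_mul (Real.exp_pos _).le, mul_left_comm, ← Real.exp_add]
  refine ENNReal.ofReal_le_ofReal (le_of_eq ?_)
  congr 2
  rw [hg]
  ring

/-- Moderate deviation principle for random sums, for general scaling sequences. -/
theorem satisfiesLDP_randomSum (hX : ∀ i, Measurable (X i))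
    (hindep : iIndepFun X P) (hident : ∀ i, IdentDistrib (X i) (X 0) P P)
    (h0 : 0 ∈ interior (integrableExpSet (X 0) P))
    (hmean : ∫ ω, X 0 ω ∂P = 0) (hvar : variance (X 0) P = 1)
    (hν : ∀ k, Measurable (ν k))
    (hνS : ∀ k m, IndepFun (ν k) (fun ω => ∑ i ∈ Finset.range m, X i ω) P)
    (hab : ∀ᶠ k in atTop, 0 < a k ∧ 0 < b k ∧ a k ^ 2 = r k * b k)
    (hlim : Tendsto (fun k => a k / b k) atTop (𝓝 0))
    (hLDP : SatisfiesLDP P (fun k ω => (ν k ω : ℝ) / b k) r I)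
    (hconv : ConvexOn ℝ≥0 Set.univ I) (hItop : Tendsto I atTop (𝓝 ∞))
    (hfin : ∃ s : ℝ, 0 < s ∧ I s ≠ ∞) :
    SatisfiesLDP P (fun k ω => 1 / a k * ∑ i ∈ Finset.range (ν k ω), X i ω) r (mixedRate I) where
  speed_tendsto := hLDP.speed_tendsto
  isCompact_level := isCompact_mixedRate_level
    (lowerSemicontinuous_of_isCompact_level hLDP.isCompact_level) hconv hItop hfin
  lower_bound G hG := by
    refine le_liminf_scaled_log hLDP.speed_tendsto (fun _ => measure_ne_top P _) fun c hc => ?_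
    have hc0 : 0 < c := by
      have := (EReal.coe_ennreal_nonneg _).trans_lt hc
      exact_mod_cast this
    have hc' : (⨅ x ∈ G, mixedRate I x) < ENNReal.ofReal c := by
      rwa [← EReal.coe_ennreal_lt_coe_ennreal_iff, EReal.coe_ennreal_ofReal, max_eq_left hc0.le]
    simp only [iInf_lt_iff] at hc'
    obtain ⟨y, hyG, hyc⟩ := hc'
    rw [← EReal.coe_ennreal_lt_coe_ennreal_iff, EReal.coe_ennreal_ofReal,
      max_eq_left hc0.le] at hyc
    obtain ⟨η, hη, hball⟩ := Metric.isOpen_iff.1 hG y hyG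
    refine ⟨1 / 2, by norm_num, ?_⟩
    filter_upwards [exists_eventually_le_measure_randomSum hX hindep hident h0 hmean hvar hν hνS
      hab hlim hLDP hη hyc, hab] with k hk ⟨ha, _, _⟩
    refine hk.trans (measure_mono fun ω hω => hball ?_)
    have hω' : |∑ i ∈ Finset.range (ν k ω), X i ω - y * a k| < η * a k := hω
    rw [Metric.mem_ball, Real.dist_eq]
    have heq : 1 / a k * ∑ i ∈ Finset.range (ν k ω), X i ω - y =
        (∑ i ∈ Finset.range (ν k ω), X i ω - y * a k) / a k := by field_simp
    rwa [heq, abs_div, abs_of_pos ha, div_lt_iff₀ ha]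
  upper_bound A hA := by
    refine limsup_scaled_log_le hLDP.speed_tendsto (fun _ => measure_ne_top P _) fun c hc => ?_
    rcases A.eq_empty_or_nonempty with rfl | hne
    · exact ⟨0, by simp⟩
    -- A point of A nearest the origin has the smallest rate on A, and A lies in {|x| ≥ |z|}.
    obtain ⟨z, hz, hdist⟩ := hA.exists_infDist_eq_dist hne 0
    have hmin : ∀ x ∈ A, |z| ≤ |x| := fun x hx => by
      simpa [hdist] using Metric.infDist_le_dist_of_mem (x := (0 : ℝ)) hx
    have hcz : (c : EReal) < mixedRate I |z| := by
      refine hc.trans_le (EReal.coe_ennreal_le_coe_ennreal_iff.2 ((iInf₂_le z hz).trans ?_))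
      exact mixedRate_mono_abs (abs_abs z).ge
    obtain ⟨C, hC⟩ := exists_eventually_measure_abs_randomSum_ge_le hX hindep hident h0 hmean hvar
      hν hνS hab hlim hLDP hconv hItop hfin (abs_nonneg z) hcz
    refine ⟨C, ?_⟩
    filter_upwards [hC, hab] with k hk ⟨ha, _, _⟩
    refine (measure_mono fun ω hω => ?_).trans hk
    have h1 := hmin _ hω
    rw [abs_mul, abs_of_pos (one_div_pos.2 ha), one_div, inv_mul_eq_div, le_div_iff₀ ha] at h1
    exact h1

end Transfer

theorem mainTheorem4 {Ω : Type*} [MeasurableSpace Ω] (P : Measure Ω) [IsProbabilityMeasure P]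
    (X : ℕ → Ω → ℝ) (ν : ℕ → Ω → ℕ) (α γ : ℝ) (I : ℝ → ℝ≥0∞)
    (hα : 0 < α) (hα' : α < 1 / 2) (hγ : 0 < γ) (hγα : γ ≤ 2 * α)
    -- the summands: i.i.d., centred, variance one, locally finite moment generating function
    (hX : ∀ i, Measurable (X i)) (hindep : iIndepFun X P)
    (hident : ∀ i, IdentDistrib (X i) (X 0) P P)
    (hmean : ∫ ω, X 0 ω ∂P = 0) (hvar : variance (X 0) P = 1)
    (hmgf : ∃ D : ℝ, 0 < D ∧
      ∀ t ∈ Set.Ioo (-D) D, Integrable (fun ω => Real.exp (t * X 0 ω)) P)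
    -- the summation indices: independent of the summands, with finite means tending to infinity
    (hν : ∀ k, Measurable (ν k)) (hνX : ∀ k, IndepFun (ν k) (fun ω i => X i ω) P)
    (hνint : ∀ k, Integrable (fun ω => (ν k ω : ℝ)) P)
    (hμ : Tendsto (indexMean P ν) atTop atTop)
    -- the large deviation principle for the rescaled summation indices
    (hLDP : SatisfiesLDP P
      (fun k ω => (ν k ω : ℝ) / (indexMean P ν k) ^ (1 + 2 * α - γ))
      (fun k => (indexMean P ν k) ^ γ) I)
    (hconv : ConvexOn ℝ≥0 Set.univ I)
    (hlim : Tendsto I atTop (𝓝 ∞))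
    (hfin : ∃ s : ℝ, 0 < s ∧ I s ≠ ∞) :
    SatisfiesLDP P (scaledRandomSum P X ν α) (fun k => (indexMean P ν k) ^ γ) (mixedRate I) := by

  obtain ⟨D, hD, hint⟩ := hmgf
  have h0 : 0 ∈ interior (integrableExpSet (X 0) P) :=
    mem_interior_iff_mem_nhds.2 (mem_of_superset (Ioo_mem_nhds (neg_neg_of_pos hD) hD) hint)
  have hνS : ∀ k m, IndepFun (ν k) (fun ω => ∑ i ∈ Finset.range m, X i ω) P := fun k m =>
    (hνX k).comp (φ := id) (ψ := fun x : ℕ → ℝ => ∑ i ∈ Finset.range m, x i) measurable_id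
      (by fun_prop)
  -- The exponent of b/a; γ ≤ 2α and α < 1/2 make it at least 1/2 - α > 0.
  have hexp : 0 < 1 / 2 + α - γ := by linarith
  refine satisfiesLDP_randomSum (a := fun k => indexMean P ν k ^ (1 / 2 + α)) hX hindep hident
    h0 hmean hvar hν hνS ?_ ?_ hLDP hconv hlim hfin
  · filter_upwards [hμ.eventually_gt_atTop 0] with k hk
    refine ⟨by positivity, by positivity, ?_⟩
    rw [← Real.rpow_natCast, ← Real.rpow_mul hk.le, ← Real.rpow_add hk]
    congr 1
    push_cast
    ring
  · refine ((tendsto_rpow_neg_atTop hexp).comp hμ).congr' ?_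
    filter_upwards [hμ.eventually_gt_atTop 0] with k hk
    rw [Function.comp_apply, ← Real.rpow_sub hk]
    congr 1
    ring
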